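/- Let $\mathbf K$ be the quaternions $\mathbf H$ or the octonions $\mathbf O$, with conjugation $a\mapsto\tilde a$ and standard generators $i_0=1,i_1,\dots,i_m$ ($m=3$ or $m=7$). Let $X$ be a Hilbert space over $\mathbf K$, that is, a real vector space with the following structure. - There are left and right multiplications by scalars of $\mathbf K$. They are distributive, extend the multiplication by real numbers, and are associative if $\mathbf K=\mathbf H$ and alternative ($b(bv)=b^2v$, $(vb)b=vb^2$) if $\mathbf K=\mathbf O$. - There is an $\mathbf R$-bilinear scalar product $\langle\cdot;\cdot\rangle:X\times X\to\mathbf K$ with $\langle x;y\rangle=\widetilde{\langle y;x\rangle}$ and with $\langle x;x\rangle\geq 0$ real, zero only for $x=0$. It satisfies $\langle xa;yb\rangle=\tilde a\langle x;y\rangle b$ if $\mathbf K=\mathbf H$, and $\langle xa;x\rangle=\tilde a\langle x;x\rangle$ if $\mathbf K=\mathbf O$. - There is a decomposition $X=X_0i_0\oplus\dots\oplus X_mi_m$ with pairwise isomorphic real subspaces $X_0,\dots,X_m$ of $X$, such that $\langle x_p;y_q\rangle\in\mathbf R$ and $\langle x_pi_p;y_qi_q\rangle=\langle x_p;y_q\rangle\,\tilde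 i_p i_q$ for $x_p\in X_p$, $y_q\in X_q$. - $X$ is complete in the norm $\|x\|=\langle x;x\rangle^{1/2}$, and $\|av\|=\|va\|=|a|\,\|v\|$ for $a\in\mathbf K$, $v\in X$. Let $L_q(X)$ be the algebra of all bounded quasilinear (i.e. additive and $\mathbf R$-homogeneous) operators on $X$ with the operator norm. Let $T\mapsto T^*$ be the adjoint with respect to the real scalar product $\operatorname{Re}\langle x;y\rangle$. The strong operator topology on $L_q(X)$ is the topology with basic neighbourhoods $\{B:\|(B-A)x_j\|<b,\ j=1,\dots,n\}$ of $A$, and $cl_s$ denotes closure in it. For $\mathcal S\subset L_q(X)$ put $B(\mathcal S,0,1)=\{T\in\mathcal S:\|T\|\le 1\}$. Let $\mathcal C\subset L_q(X)$ be a selfadjoint $C^*$-algebra of operators over $\mathbf K$: a real-linear subspace that is closed in the operator norm and closed under composition, under $T\mapsto T^*$, and under $T\mapsto bT$, $(bT)(x)=b(T(x))$, for every $b\in\mathbf K$ (a unit is not required). Then: 1. $B(cl_s(\mathcal C),0,1)\subset cl_s(B(\mathcal C,0,1))$. 2. If $T\in B(cl_s(\mathcal C),0,1)$ and $T=T^*$,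 then $T\in cl_s(\{S\in B(\mathcal C,0,1):S=S^*\})$. -/

import Mathlib

open scoped Quaternion

noncomputable section

namespace HyperOp

/-! ### The scalars: quaternions and octonions -/

/-- The octonions, as pairs `α + β l` of quaternions, with the Euclidean norm
`|α + β l|² = |α|² + |β|²`. -/
def Octonion : Type := WithLp 2 (ℍ[ℝ] × ℍ[ℝ])

namespace Octonion

instance : NormedAddCommGroup Octonion :=
  inferInstanceAs (NormedAddCommGroup (WithLp 2 (ℍ[ℝ] × ℍ[ℝ])))

instance : InnerProductSpace ℝ Octonion :=
  inferInstanceAs (InnerProductSpace ℝ (WithLp 2 (ℍ[ℝ] × ℍ[ℝ])))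

/-- The octonion `a + b l`. -/
def mk (a b : ℍ[ℝ]) : Octonion := WithLp.toLp 2 (a, b)

/-- The component `α` of `α + β l`. -/
def fst (z : Octonion) : ℍ[ℝ] := (WithLp.ofLp z).1

/-- The component `β` of `α + β l`. -/
def snd (z : Octonion) : ℍ[ℝ] := (WithLp.ofLp z).2

instance : One Octonion := ⟨mk 1 0⟩

/-- The doubling product
`(α + β l)(γ + δ l) = (α γ - conj δ β) + (δ α + β conj γ) l`. -/
instance : Mul Octonion :=
  ⟨fun z w => mk (z.fst * w.fst - star w.snd * z.snd) (w.snd * z.fst + z.snd * star w.fst)⟩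

/-- The conjugation `α + β l ↦ conj α - β l`. -/
instance : Star Octonion := ⟨fun z => mk (star z.fst) (-z.snd)⟩

end Octonion

/-- The standard generators `i₀ = 1, i₁, …, iₘ` of a real algebra `K`. -/
class StandardGenerators (K : Type) where
  /-- The number `m + 1` of generators. -/
  count : ℕ
  /-- The generators. -/
  gen : Fin count → K

/-- `1, i, j, k`. -/
def quaternionGen : Fin 4 → ℍ[ℝ] := ![⟨1, 0, 0, 0⟩, ⟨0, 1, 0, 0⟩, ⟨0, 0, 1, 0⟩, ⟨0, 0, 0, 1⟩]

instance : StandardGenerators ℍ[ℝ] := ⟨4, quaternionGen⟩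

/-- `1, i, j, k, l, il, jl, kl`. -/
instance : StandardGenerators Octonion :=
  ⟨4 + 4, Fin.append (fun p => Octonion.mk (quaternionGen p) 0)
    (fun p => Octonion.mk 0 (quaternionGen p))⟩

/-! ### Hilbert spaces over the quaternions and the octonions -/

/-- The structure common to Hilbert spaces over `K`, for `K` the quaternions or the octonions:
left and right multiplication by scalars, distributive and alternative, a `K`-valued scalar
product, and a decomposition `X = X₀ i₀ ⊕ X₁ i₁ ⊕ … ⊕ Xₘ iₘ` compatible with it.
A real scalar `r` is identified with `r • 1 : K`. The norm of `X` is the one given by the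
`K`-valued scalar product (`ip_self`), hence the real inner product of `X` is its real part
(see `re_ip` below); this is the underlying real Hilbert space of `X`. Completeness is a
separate hypothesis. -/
class HilbertSpaceOver (K : Type) [NormedAddCommGroup K] [NormedSpace ℝ K] [Mul K] [One K]
    [Star K] [StandardGenerators K] (X : Type*) [NormedAddCommGroup X]
    [InnerProductSpace ℝ X] where
  /-- `a v`. -/
  lmul : K → X → X
  /-- `v a`. -/
  rmul : X → K → X
  add_lmul : ∀ (a b : K) (v : X), lmul (a + b) v = lmul a v + lmul b v
  lmul_add : ∀ (a : K) (v w : X), lmul a (v + w) = lmul a v + lmul a w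
  rmul_add : ∀ (v : X) (a b : K), rmul v (a + b) = rmul v a + rmul v b
  add_rmul : ∀ (v w : X) (a : K), rmul (v + w) a = rmul v a + rmul w a
  lmul_real : ∀ (r : ℝ) (v : X), lmul (r • (1 : K)) v = r • v
  rmul_real : ∀ (r : ℝ) (v : X), rmul v (r • (1 : K)) = r • v
  lmul_alt : ∀ (b : K) (v : X), lmul b (lmul b v) = lmul (b * b) v
  rmul_alt : ∀ (v : X) (b : K), rmul (rmul v b) b = rmul v (b * b)
  norm_lmul : ∀ (a : K) (v : X), ‖lmul a v‖ = ‖a‖ * ‖v‖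
  norm_rmul : ∀ (v : X) (a : K), ‖rmul v a‖ = ‖a‖ * ‖v‖
  /-- The `K`-valued scalar product `⟨x; y⟩`. -/
  ip : X → X → K
  ip_self : ∀ x : X, ip x x = (‖x‖ ^ 2 : ℝ) • (1 : K)
  ip_symm : ∀ x y : X, ip x y = star (ip y x)
  ip_add_left : ∀ x y z : X, ip (x + y) z = ip x z + ip y z
  ip_add_right : ∀ x y z : X, ip x (y + z) = ip x y + ip x z
  ip_smul_left : ∀ (r : ℝ) (x y : X), ip (r • x) y = r • ip x y
  ip_smul_right : ∀ (r : ℝ) (x y : X), ip x (r • y) = r • ip x y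
  ip_rmul_self : ∀ (x : X) (a : K), ip (rmul x a) x = star a * ip x x
  /-- The real vector spaces `X₀, …, Xₘ`. -/
  comp : Fin (StandardGenerators.count K) → Submodule ℝ X
  comp_iso : ∀ p q, Nonempty (comp p ≃ₗ[ℝ] comp q)
  decomp : ∀ x : X, ∃! v : (∀ p, comp p), x = ∑ p, rmul (v p : X) (StandardGenerators.gen p)
  ip_comp_real : ∀ p q, ∀ x ∈ comp p, ∀ y ∈ comp q, ∃ r : ℝ, ip x y = r • (1 : K)
  ip_comp : ∀ p q, ∀ x ∈ comp p, ∀ y ∈ comp q,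
    ip (rmul x (StandardGenerators.gen p)) (rmul y (StandardGenerators.gen q)) =
      ip x y * (star (StandardGenerators.gen p) * StandardGenerators.gen q)

/-- A (not yet complete) Hilbert space over the quaternions: both multiplications are associative
and `⟨x a; y b⟩ = conj a ⟨x; y⟩ b`. -/
class QuaternionHilbertSpace (X : Type*) [NormedAddCommGroup X] [InnerProductSpace ℝ X] extends
    HilbertSpaceOver ℍ[ℝ] X where
  lmul_assoc : ∀ (a b : ℍ[ℝ]) (v : X), lmul a (lmul b v) = lmul (a * b) v
  rmul_assoc : ∀ (v : X) (a b : ℍ[ℝ]), rmul (rmul v b) a = rmul v (b * a)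
  ip_rmul : ∀ (x y : X) (a b : ℍ[ℝ]), ip (rmul x a) (rmul y b) = star a * ip x y * b

/-- A (not yet complete) Hilbert space over the octonions. -/
abbrev OctonionHilbertSpace (X : Type*) [NormedAddCommGroup X] [InnerProductSpace ℝ X] :=
  HilbertSpaceOver Octonion X

section Operators

variable (K : Type) [NormedAddCommGroup K] [NormedSpace ℝ K] [Mul K] [One K]
  [Star K] [StandardGenerators K] {X : Type*} [NormedAddCommGroup X] [InnerProductSpace ℝ X]

/-- The real part `(z + conj z) / 2` of `z = ⟨x; y⟩` is the real inner product of `x` and `y`. -/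
theorem re_ip [HilbertSpaceOver K X] (x y : X) :
    HilbertSpaceOver.ip x y + star (HilbertSpaceOver.ip x y : K) =
      (2 * inner ℝ x y : ℝ) • (1 : K) := by
  have h := HilbertSpaceOver.ip_self (K := K) (x + y)
  rw [HilbertSpaceOver.ip_add_left, HilbertSpaceOver.ip_add_right,
    HilbertSpaceOver.ip_add_right, HilbertSpaceOver.ip_self, HilbertSpaceOver.ip_self,
    HilbertSpaceOver.ip_symm y x, norm_add_sq_real, add_smul, add_smul] at h
  rw [← sub_eq_zero] at h ⊢
  rw [← h]
  abel

variable {K}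

/-- Left multiplication `x ↦ b x`, as a bounded quasilinear operator. -/
def lmulCLM [HilbertSpaceOver K X] (b : K) : X →L[ℝ] X :=
  AddMonoidHom.toRealLinearMap
    (AddMonoidHom.mk' (HilbertSpaceOver.lmul b) (HilbertSpaceOver.lmul_add b))
    (AddMonoidHomClass.continuous_of_bound
      (AddMonoidHom.mk' (HilbertSpaceOver.lmul b : X → X) (HilbertSpaceOver.lmul_add b)) ‖b‖
      (fun x => (HilbertSpaceOver.norm_lmul b x).le))

/-- The strong operator topology on the bounded quasilinear (that is, real-linear) operators:
the topology of pointwise convergence on `X`. -/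
abbrev strongOperatorTopology (X : Type*) [NormedAddCommGroup X] [InnerProductSpace ℝ X] :
    TopologicalSpace (X →L[ℝ] X) :=
  TopologicalSpace.induced (fun (A : X →L[ℝ] X) (x : X) => A x) inferInstance

/-- Closure in the strong operator topology. -/
def strongClosure (S : Set (X →L[ℝ] X)) : Set (X →L[ℝ] X) :=
  @closure _ (strongOperatorTopology X) S

/-- The description of the strong closure by the basic neighbourhoods
`{B : ‖(B - A) x‖ < b for all x ∈ F}`, with `F` finite and `b > 0`. -/
theorem mem_strongClosure_iff (S : Set (X →L[ℝ] X)) (A : X →L[ℝ] X) :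
    A ∈ strongClosure S ↔
      ∀ (F : Finset X) (b : ℝ), 0 < b → ∃ B ∈ S, ∀ x ∈ F, ‖(B - A) x‖ < b := by
  rw [strongClosure, closure_induced, mem_closure_iff_nhds]
  constructor
  · intro h F b hb
    have hU : {g : X → X | ∀ x ∈ F, ‖g x - A x‖ < b} ∈ nhds (fun x => A x) := by
      apply IsOpen.mem_nhds
      · have : {g : X → X | ∀ x ∈ F, ‖g x - A x‖ < b} =
            ⋂ x ∈ F, {g : X → X | ‖g x - A x‖ < b} := by
          ext g
          simp
        rw [this]
        exact isOpen_biInter_finset fun x _ =>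
          isOpen_lt (((continuous_apply x).sub continuous_const).norm) continuous_const
      · intro x _
        simpa using hb
    obtain ⟨g, hg, B, hB, rfl⟩ := h _ hU
    exact ⟨B, hB, fun x hx => hg x hx⟩
  · intro h U hU
    rw [nhds_pi, Filter.mem_pi'] at hU
    obtain ⟨I, t, ht, hsub⟩ := hU
    have hev : ∀ᶠ b : ℝ in nhdsWithin 0 (Set.Ioi 0), ∀ x ∈ I, Metric.ball (A x) b ⊆ t x := by
      rw [Filter.eventually_all_finset]
      intro x _
      obtain ⟨e, he, hball⟩ := Metric.mem_nhds_iff.1 (ht x)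
      filter_upwards [Ioo_mem_nhdsGT he] with b hb
      exact (Metric.ball_subset_ball hb.2.le).trans hball
    obtain ⟨b, hb, hb0⟩ := (hev.and self_mem_nhdsWithin).exists
    obtain ⟨B, hB, hlt⟩ := h I b hb0
    refine ⟨fun x => B x, hsub fun x hx => hb x hx ?_, B, hB, rfl⟩
    rw [Metric.mem_ball, dist_eq_norm]
    exact hlt x hx

/-- A selfadjoint C*-algebra over `K` of operators contained in the algebra of all bounded
quasilinear operators of `X`: a real-linear subspace closed under composition and adjoints
(both contained in `NonUnitalStarSubalgebra ℝ`; the adjoint is the one of the underlying real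
Hilbert space), closed in the operator norm, and closed under `T ↦ b T`, `(b T)(x) = b (T x)`,
for `b` in `K`. It is not required to contain a unit. -/
structure IsCStarAlgebraOver (K : Type) [NormedAddCommGroup K] [NormedSpace ℝ K] [Mul K] [One K]
    [Star K] [StandardGenerators K] {X : Type*} [NormedAddCommGroup X] [InnerProductSpace ℝ X]
    [CompleteSpace X] [HilbertSpaceOver K X]
    (C : NonUnitalStarSubalgebra ℝ (X →L[ℝ] X)) : Prop where
  isClosed : IsClosed (C : Set (X →L[ℝ] X))
  lmul_mem : ∀ (b : K), ∀ T ∈ C, (lmulCLM b).comp T ∈ C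

end Operators

end HyperOp

end

open HyperOp

namespace HyperOp

noncomputable section

open Filter Topology ContinuousLinearMap

variable {X : Type*} [NormedAddCommGroup X] [InnerProductSpace ℝ X]

/-! ### Algebra and adjoints in the strong closure -/

section StrongClosure

/-! This is Kaplansky's density theorem, proved in the underlying real Hilbert space without
functional calculus. The map f(S) = 2S(1 + S*S)⁻¹ sends every operator to a contraction, preserves a
norm-closed selfadjoint algebra, commutes with adjoints, and is continuous when S and S* both
converge strongly (`norm_boundedTransform_sub_apply_le`). If ‖T‖ < 1 and T lies in the strong
closure, then T = f(A) for some A in that closure, found as a fixed point of A ↦ T(1 + A*A)/2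
(`exists_boundedTransform_eq`). Approximants S of A in the algebra can be chosen with S* near A* as
well (`exists_starStrong_approx`), so the contractions f(S) approximate T together with their
adjoints. Rescaling covers ‖T‖ = 1, and averaging an approximant with its adjoint gives the
selfadjoint case. -/

theorem add_mem_strongClosure {C : NonUnitalSubalgebra ℝ (X →L[ℝ] X)} {S T : X →L[ℝ] X}
    (hS : S ∈ strongClosure (C : Set (X →L[ℝ] X))) (hT : T ∈ strongClosure (C : Set (X →L[ℝ] X))) :
    S + T ∈ strongClosure (C : Set (X →L[ℝ] X)) := by
  rw [mem_strongClosure_iff] at *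
  intro F b hb
  obtain ⟨A, hA, hAS⟩ := hS F (b / 2) (half_pos hb)
  obtain ⟨B, hB, hBT⟩ := hT F (b / 2) (half_pos hb)
  refine ⟨A + B, C.add_mem hA hB, fun x hx => ?_⟩
  calc ‖(A + B - (S + T)) x‖ = ‖(A - S) x + (B - T) x‖ := by
        congr 1; simp only [sub_apply, add_apply]; abel
    _ ≤ ‖(A - S) x‖ + ‖(B - T) x‖ := norm_add_le _ _
    _ < b := by linarith [hAS x hx, hBT x hx]

theorem mul_mem_strongClosure {C : NonUnitalSubalgebra ℝ (X →L[ℝ] X)} {S T : X →L[ℝ] X}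
    (hS : S ∈ strongClosure (C : Set (X →L[ℝ] X))) (hT : T ∈ strongClosure (C : Set (X →L[ℝ] X))) :
    S * T ∈ strongClosure (C : Set (X →L[ℝ] X)) := by
  classical
  rw [mem_strongClosure_iff] at *
  intro F b hb
  obtain ⟨A, hA, hAS⟩ := hS (F.image T) (b / 2) (half_pos hb)
  have hA0 : 0 < ‖A‖ + 1 := by positivity
  -- Multiplication is not jointly strongly continuous, so A is fixed first and the tolerance for B
  -- depends on ‖A‖.
  obtain ⟨B, hB, hBT⟩ := hT F (b / 2 / (‖A‖ + 1)) (by positivity)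
  refine ⟨A * B, C.mul_mem hA hB, fun x hx => ?_⟩
  have h1 := hAS (T x) (Finset.mem_image_of_mem _ hx)
  have h2 := hBT x hx
  rw [lt_div_iff₀ hA0] at h2
  calc ‖(A * B - S * T) x‖ = ‖A ((B - T) x) + (A - S) (T x)‖ := by
        congr 1; simp only [sub_apply, map_sub, mul_apply_eq_comp]; abel
    _ ≤ ‖A ((B - T) x)‖ + ‖(A - S) (T x)‖ := norm_add_le _ _
    _ ≤ ‖A‖ * ‖(B - T) x‖ + ‖(A - S) (T x)‖ := by gcongr; exact A.le_opNorm _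
    _ < b := by nlinarith [norm_nonneg ((B - T) x)]

theorem smul_mem_strongClosure {C : NonUnitalSubalgebra ℝ (X →L[ℝ] X)} {T : X →L[ℝ] X}
    (r : ℝ) (hT : T ∈ strongClosure (C : Set (X →L[ℝ] X))) :
    r • T ∈ strongClosure (C : Set (X →L[ℝ] X)) := by
  rw [mem_strongClosure_iff] at *
  intro F b hb
  have hr : 0 < |r| + 1 := by positivity
  obtain ⟨B, hB, hBT⟩ := hT F (b / (|r| + 1)) (by positivity)
  refine ⟨r • B, C.smul_mem r hB, fun x hx => ?_⟩
  have h2 := hBT x hx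
  rw [lt_div_iff₀ hr] at h2
  rw [← smul_sub, smul_apply, norm_smul, Real.norm_eq_abs]
  nlinarith [norm_nonneg ((B - T) x)]

theorem isClosed_strongClosure (S : Set (X →L[ℝ] X)) : IsClosed (strongClosure S) := by
  have h : strongClosure S = (fun (A : X →L[ℝ] X) (x : X) => A x) ⁻¹'
      closure ((fun (A : X →L[ℝ] X) (x : X) => A x) '' S) :=
    Set.ext fun _ => closure_induced
  rw [h]
  exact isClosed_closure.preimage (continuous_pi fun x => continuous_eval_const x)

variable [CompleteSpace X]

/-- Strong approximants from a selfadjoint algebra can be chosen so that their adjoints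
approximate as well. -/
theorem exists_starStrong_approx {C : NonUnitalStarSubalgebra ℝ (X →L[ℝ] X)} {T : X →L[ℝ] X}
    (hT : T ∈ strongClosure (C : Set (X →L[ℝ] X))) (F : Finset X) {b : ℝ} (hb : 0 < b) :
    ∃ B ∈ C, ∀ x ∈ F, ‖(B - T) x‖ < b ∧ ‖(star B - star T) x‖ < b := by
  let Φ : (X →L[ℝ] X) →ₗ[ℝ] PiLp 2 (fun _ : F ⊕ F => X) :=
    { toFun := fun S => WithLp.toLp 2 (Sum.elim (fun x : F => S x) (fun x : F => (star S) x))
      map_add' := fun S R => by ext i; cases i <;> simp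
      map_smul' := fun r S => by ext i; cases i <;> simp }
  let W : Submodule ℝ (PiLp 2 (fun _ : F ⊕ F => X)) := C.toSubmodule.map Φ
  have key : Φ T ∈ W.topologicalClosure := by
    rw [← Submodule.orthogonal_orthogonal_eq_closure, Submodule.mem_orthogonal]
    intro u hu
    -- Moving the adjoint across, ⟨u, S*x⟩ = ⟨Su, x⟩, makes the functional S ↦ ⟨u, Φ S⟩ strongly
    -- continuous. It vanishes on C, hence at T.
    let g : (X → X) → ℝ := fun h =>
      ∑ x : F, inner ℝ (u (Sum.inl x)) (h x) + ∑ x : F, inner ℝ (h (u (Sum.inr x))) (x : X)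
    have hg : Continuous g := by fun_prop
    have hgΦ : ∀ S : X →L[ℝ] X, inner ℝ u (Φ S) = g S := by
      intro S
      simp only [PiLp.inner_apply, Fintype.sum_sum_type, g]
      congr 1
      refine Finset.sum_congr rfl fun x _ => ?_
      change inner ℝ (u (Sum.inr x)) ((adjoint S) x) = _
      rw [adjoint_inner_right]
    rw [hgΦ]
    rw [strongClosure, closure_induced] at hT
    refine closure_minimal (t := {h | g h = 0}) ?_ (isClosed_eq hg continuous_const) hT
    rintro _ ⟨S, hS, rfl⟩
    change g S = 0
    rw [← hgΦ]
    exact (Submodule.mem_orthogonal' _ _).1 hu _ (Submodule.mem_map_of_mem hS)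
  obtain ⟨_, ⟨B, hB, rfl⟩, hd⟩ := Metric.mem_closure_iff.1 key b hb
  rw [dist_comm, dist_eq_norm, ← map_sub] at hd
  refine ⟨B, hB, fun x hx => ⟨?_, ?_⟩⟩
  · exact (PiLp.norm_apply_le (Φ (B - T)) (Sum.inl ⟨x, hx⟩)).trans_lt hd
  · rw [← star_sub]
    exact (PiLp.norm_apply_le (Φ (B - T)) (Sum.inr ⟨x, hx⟩)).trans_lt hd

theorem star_mem_strongClosure {C : NonUnitalStarSubalgebra ℝ (X →L[ℝ] X)} {T : X →L[ℝ] X}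
    (hT : T ∈ strongClosure (C : Set (X →L[ℝ] X))) :
    star T ∈ strongClosure (C : Set (X →L[ℝ] X)) := by
  rw [mem_strongClosure_iff]
  intro F b hb
  obtain ⟨B, hB, h⟩ := exists_starStrong_approx hT F hb
  exact ⟨star B, C.star_mem' hB, fun x hx => (h x hx).2⟩

end StrongClosure

/-! ### The transform 2S(1 + S*S)⁻¹ -/

section BoundedTransform

variable [CompleteSpace X]

theorem norm_star_operator (S : X →L[ℝ] X) : ‖star S‖ = ‖S‖ := norm_star S

theorem norm_sq_one_add_star_mul_self (S : X →L[ℝ] X) (x : X) :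
    ‖(1 + star S * S) x‖ ^ 2 = ‖x‖ ^ 2 + 2 * ‖S x‖ ^ 2 + ‖(star S * S) x‖ ^ 2 := by
  have h : inner ℝ x ((star S * S) x) = ‖S x‖ ^ 2 := by
    rw [mul_apply_eq_comp, star_eq_adjoint, adjoint_inner_right, real_inner_self_eq_norm_sq]
  rw [add_apply, norm_add_sq_real, one_apply_eq_self, h]

theorem norm_le_norm_one_add_star_mul_self (S : X →L[ℝ] X) (x : X) :
    ‖x‖ ≤ ‖(1 + star S * S) x‖ := by
  refine le_of_sq_le_sq ?_ (norm_nonneg _)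
  rw [norm_sq_one_add_star_mul_self]
  nlinarith [sq_nonneg ‖S x‖, sq_nonneg ‖(star S * S) x‖]

/-- The difference of squares of the two sides is ‖x - S*Sx‖². This is what makes the bounded
transform a contraction. -/
theorem two_mul_norm_le_norm_one_add_star_mul_self (S : X →L[ℝ] X) (x : X) :
    2 * ‖S x‖ ≤ ‖(1 + star S * S) x‖ := by
  have h : inner ℝ x ((star S * S) x) = ‖S x‖ ^ 2 := by
    rw [mul_apply_eq_comp, star_eq_adjoint, adjoint_inner_right, real_inner_self_eq_norm_sq]
  have h' := norm_sub_sq_real x ((star S * S) x)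
  refine le_of_sq_le_sq ?_ (norm_nonneg _)
  rw [norm_sq_one_add_star_mul_self]
  rw [h] at h'
  nlinarith [sq_nonneg ‖x - (star S * S) x‖]

/-- Up to a positive scalar, `1 + S* S` is a perturbation of the identity of norm less than one. -/
theorem exists_norm_one_sub_smul_lt_one (S : X →L[ℝ] X) :
    ∃ c : ℝ, 0 < c ∧ ‖1 - c • (1 + star S * S)‖ < 1 := by
  set P := 1 + star S * S with hP
  -- With c = 1/M, P ≥ 1 and ‖Px‖² ≤ M‖x‖² give ‖x - cPx‖² ≤ (1 - 2c + c²M)‖x‖² = (1 - c)‖x‖².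
  set M := ‖P‖ ^ 2 + 1 with hM
  have hM0 : 1 ≤ M := by nlinarith [sq_nonneg ‖P‖]
  have hM1 : 0 < M := by linarith
  refine ⟨M⁻¹, by positivity, ?_⟩
  have hi : M⁻¹ ≤ 1 := inv_le_one_of_one_le₀ hM0
  have hi0 : 0 < M⁻¹ := by positivity
  have hs : Real.sqrt (1 - M⁻¹) < 1 := by
    rw [Real.sqrt_lt' one_pos]; linarith
  refine lt_of_le_of_lt (opNorm_le_bound _ (Real.sqrt_nonneg _) fun x => ?_) hs
  refine le_of_sq_le_sq ?_ (by positivity)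
  have hin : ‖x‖ ^ 2 ≤ inner ℝ x (P x) := by
    have : inner ℝ x (P x) = ‖x‖ ^ 2 + ‖S x‖ ^ 2 := by
      rw [hP, add_apply, inner_add_right, one_apply_eq_self, real_inner_self_eq_norm_sq, mul_apply_eq_comp,
        star_eq_adjoint, adjoint_inner_right, real_inner_self_eq_norm_sq]
    rw [this]; nlinarith [sq_nonneg ‖S x‖]
  have hPx : ‖P x‖ ^ 2 ≤ M * ‖x‖ ^ 2 := by
    have := pow_le_pow_left₀ (norm_nonneg _) (P.le_opNorm x) 2
    rw [mul_pow] at this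
    nlinarith [sq_nonneg ‖x‖]
  rw [mul_pow, Real.sq_sqrt (by linarith), sub_apply, one_apply_eq_self, smul_apply, norm_sub_sq_real,
    inner_smul_right, norm_smul, mul_pow, Real.norm_eq_abs, sq_abs]
  have h3 : M⁻¹ ^ 2 * ‖P x‖ ^ 2 ≤ M⁻¹ * ‖x‖ ^ 2 := by
    calc M⁻¹ ^ 2 * ‖P x‖ ^ 2 ≤ M⁻¹ ^ 2 * (M * ‖x‖ ^ 2) := by gcongr
      _ = M⁻¹ * ‖x‖ ^ 2 := by field_simp
  have h4 := mul_le_mul_of_nonneg_left hin hi0.le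
  nlinarith

theorem isUnit_one_add_star_mul_self (S : X →L[ℝ] X) : IsUnit (1 + star S * S) := by
  obtain ⟨c, hc, h⟩ := exists_norm_one_sub_smul_lt_one S
  have h1 := isUnit_one_sub_of_norm_lt_one h
  rw [sub_sub_cancel] at h1
  have h2 := h1.smul (Units.mk0 c hc.ne')⁻¹
  rwa [Units.smul_def, Units.val_inv_eq_inv_val, Units.val_mk0, inv_smul_smul₀ hc.ne'] at h2

/-- The bounded transform `2 S (1 + S* S)⁻¹`, which maps all operators to contractions. -/
def boundedTransform (S : X →L[ℝ] X) : X →L[ℝ] X :=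
  (2 : ℝ) • (S * Ring.inverse (1 + star S * S))

theorem boundedTransform_mul (S : X →L[ℝ] X) :
    boundedTransform S * (1 + star S * S) = (2 : ℝ) • S := by
  rw [boundedTransform, smul_mul_assoc, mul_assoc,
    Ring.inverse_mul_cancel _ (isUnit_one_add_star_mul_self S), mul_one]

theorem eq_boundedTransform {S T : X →L[ℝ] X} (h : T * (1 + star S * S) = (2 : ℝ) • S) :
    T = boundedTransform S :=
  (isUnit_one_add_star_mul_self S).mul_right_cancel (h.trans (boundedTransform_mul S).symm)

/-- Rests on the intertwining (1 + S*S)S* = S*(1 + SS*). -/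
theorem star_boundedTransform (S : X →L[ℝ] X) :
    star (boundedTransform S) = boundedTransform (star S) := by
  refine eq_boundedTransform ((isUnit_one_add_star_mul_self S).mul_left_cancel ?_)
  have h := congrArg star (boundedTransform_mul S)
  simp only [star_mul, star_add, star_one, star_star, star_smul, star_trivial] at h
  rw [star_star, ← mul_assoc, h]
  simp only [smul_mul_assoc, mul_smul_comm, smul_add, mul_add, add_mul, mul_one, one_mul, mul_assoc]

theorem norm_boundedTransform_le (S : X →L[ℝ] X) : ‖boundedTransform S‖ ≤ 1 := by
  refine opNorm_le_bound _ zero_le_one fun x => ?_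
  have h := two_mul_norm_le_norm_one_add_star_mul_self S (Ring.inverse (1 + star S * S) x)
  rw [← mul_apply_eq_comp (1 + star S * S),
    Ring.mul_inverse_cancel _ (isUnit_one_add_star_mul_self S), one_apply_eq_self] at h
  rw [boundedTransform, smul_apply, norm_smul, mul_apply_eq_comp, one_mul]
  simpa using h

/-- Expand (1 + S*S)⁻¹ in a Neumann series. C may lack a unit, so the powers of B need not lie in C,
but their products with S on the left do. -/
theorem boundedTransform_mem {C : NonUnitalStarSubalgebra ℝ (X →L[ℝ] X)}
    (hC : IsClosed (C : Set (X →L[ℝ] X))) {S : X →L[ℝ] X} (hS : S ∈ C) :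
    boundedTransform S ∈ C := by
  obtain ⟨c, hc, h⟩ := exists_norm_one_sub_smul_lt_one S
  set B := 1 - c • (1 + star S * S) with hB
  have hmem : ∀ n : ℕ, S * B ^ n ∈ C := by
    intro n
    induction n with
    | zero => simpa using hS
    | succ n ih =>
      rw [pow_succ, ← mul_assoc, hB, mul_sub, mul_one, mul_smul_comm, mul_add, mul_one, ← hB]
      exact sub_mem ih (SMulMemClass.smul_mem c
        (add_mem ih (mul_mem ih (mul_mem (star_mem hS) hS))))
  have hsum : Summable fun n : ℕ => B ^ n := summable_geometric_of_norm_lt_one h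
  have hsum' : HasSum (fun n : ℕ => S * B ^ n) (S * ∑' n : ℕ, B ^ n) := hsum.hasSum.mul_left S
  have hmem' : S * ∑' n : ℕ, B ^ n ∈ C :=
    hC.mem_of_tendsto hsum' (Eventually.of_forall fun s => sum_mem fun n _ => hmem n)
  have hg : (∑' n : ℕ, B ^ n) * (1 - B) = 1 := geom_series_mul_neg B h
  have : ((2 : ℝ) * c) • (S * ∑' n : ℕ, B ^ n) = boundedTransform S := by
    refine eq_boundedTransform ?_
    rw [hB, sub_sub_cancel, ← hB, mul_smul_comm] at hg
    rw [smul_mul_assoc, mul_assoc, mul_smul, ← mul_smul_comm c, hg, mul_one]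
  rw [← this]
  exact SMulMemClass.smul_mem _ hmem'

/-- With f the bounded transform and Q = 1 + SS*, one has Q f(S) = 2S, whence Q(f(S) - f(A))(1 +
A*A) = 2(S - A) - Q f(S)(S* - A*)A. Since Q does not shrink vectors and ‖f(S)‖ ≤ 1, the bound is
free of ‖S‖, so unbounded families of approximants are allowed. -/
theorem norm_boundedTransform_sub_apply_le (S A : X →L[ℝ] X) (x : X) :
    ‖(boundedTransform S - boundedTransform A) ((1 + star A * A) x)‖ ≤
      2 * ‖(S - A) x‖ + ‖(star S - star A) (A x)‖ := by
  set Q := 1 + star (star S) * star S with hQ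
  have hu : IsUnit Q := isUnit_one_add_star_mul_self (star S)
  have h1 : Q * boundedTransform S = (2 : ℝ) • S := by
    have h := congrArg star (boundedTransform_mul (star S))
    rw [star_mul, star_boundedTransform, star_smul, star_star] at h
    simpa [hQ] using h
  have h2 : Q * ((boundedTransform S - boundedTransform A) * (1 + star A * A)) =
      (2 : ℝ) • (S - A) - Q * boundedTransform S * ((star S - star A) * A) := by
    rw [sub_mul, boundedTransform_mul, mul_sub, ← mul_assoc, h1, hQ, star_star]
    simp only [smul_mul_assoc, mul_smul_comm, mul_add, add_mul, mul_one, one_mul, mul_assoc,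
      mul_sub, sub_mul, smul_sub, smul_add]
    abel
  have h3 : Q ((boundedTransform S - boundedTransform A) ((1 + star A * A) x) +
      boundedTransform S ((star S - star A) (A x))) = (2 : ℝ) • (S - A) x := by
    have := congrArg (fun R : X →L[ℝ] X => R x) h2
    simp only [mul_apply_eq_comp, sub_apply, smul_apply] at this
    rw [map_add, sub_apply, this]
    simp
  have h4 := norm_le_norm_one_add_star_mul_self (star S)
    ((boundedTransform S - boundedTransform A) ((1 + star A * A) x) +
      boundedTransform S ((star S - star A) (A x)))
  rw [← hQ, h3, norm_smul, Real.norm_two] at h4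
  have h5 := (boundedTransform S).le_of_opNorm_le (norm_boundedTransform_le S)
    ((star S - star A) (A x))
  have h6 := norm_sub_le ((boundedTransform S - boundedTransform A) ((1 + star A * A) x) +
      boundedTransform S ((star S - star A) (A x))) (boundedTransform S ((star S - star A) (A x)))
  rw [add_sub_cancel_right] at h6
  linarith

/-- Every operator of norm less than one in the strong closure of a selfadjoint algebra is the
bounded transform of an operator in the strong closure. -/
theorem exists_boundedTransform_eq {C : NonUnitalStarSubalgebra ℝ (X →L[ℝ] X)} {T : X →L[ℝ] X}
    (hT : T ∈ strongClosure (C : Set (X →L[ℝ] X))) (hT1 : ‖T‖ < 1) :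
    ∃ A ∈ strongClosure (C : Set (X →L[ℝ] X)), boundedTransform A = T := by
  let s : Set (X →L[ℝ] X) := Metric.closedBall 0 1 ∩ strongClosure (C : Set (X →L[ℝ] X))
  -- Its fixed points solve T(1 + A*A) = 2A. On the unit ball A ↦ A*A is 2-Lipschitz, so φ contracts
  -- by ‖T‖ < 1.
  let φ : (X →L[ℝ] X) → (X →L[ℝ] X) := fun A => (2⁻¹ : ℝ) • (T * (1 + star A * A))
  have hs : IsComplete s :=
    (Metric.isClosed_closedBall.inter (isClosed_strongClosure _)).isComplete
  have hmaps : Set.MapsTo φ s s := by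
    rintro A ⟨hA1, hA⟩
    rw [mem_closedBall_zero_iff] at hA1
    refine ⟨?_, ?_⟩
    · rw [mem_closedBall_zero_iff]
      have h1 : ‖(1 : X →L[ℝ] X) + star A * A‖ ≤ 2 := by
        have h2 : ‖star A * A‖ ≤ 1 := by
          refine (CStarRing.norm_star_mul_self (x := A)).trans_le ?_
          nlinarith [norm_nonneg A]
        have h3 : ‖(1 : X →L[ℝ] X)‖ ≤ 1 := norm_id_le
        linarith [norm_add_le (1 : X →L[ℝ] X) (star A * A)]
      calc ‖φ A‖ = 2⁻¹ * ‖T * (1 + star A * A)‖ := by rw [norm_smul]; norm_num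
        _ ≤ 2⁻¹ * (1 * 2) := by
          gcongr
          exact (norm_mul_le _ _).trans (mul_le_mul hT1.le h1 (norm_nonneg _) zero_le_one)
        _ = 1 := by norm_num
    · have h := mul_mem_strongClosure (C := C.toNonUnitalSubalgebra) hT
        (mul_mem_strongClosure (C := C.toNonUnitalSubalgebra) (star_mem_strongClosure hA) hA)
      have h' := smul_mem_strongClosure (C := C.toNonUnitalSubalgebra) 2⁻¹
        (add_mem_strongClosure (C := C.toNonUnitalSubalgebra) hT h)
      change (2⁻¹ : ℝ) • (T * (1 + star A * A)) ∈ _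
      rwa [mul_add, mul_one]
  have hcon : ContractingWith ‖T‖₊ (hmaps.restrict φ s s) := by
    refine ⟨by exact_mod_cast hT1, LipschitzWith.of_dist_le_mul ?_⟩
    rintro ⟨A, hA, hA'⟩ ⟨B, hB, hB'⟩
    rw [mem_closedBall_zero_iff] at hA hB
    change dist (φ A) (φ B) ≤ ‖T‖ * dist A B
    rw [dist_eq_norm, dist_eq_norm]
    have h1 : φ A - φ B = (2⁻¹ : ℝ) • (T * (star A * (A - B) + star (A - B) * B)) := by
      simp only [φ, ← smul_sub, star_sub, mul_sub, sub_mul]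
      congr 2
      simp only [mul_add, mul_sub]
      abel
    have h2 : ‖star A * (A - B) + star (A - B) * B‖ ≤ 2 * ‖A - B‖ := by
      calc _ ≤ ‖star A * (A - B)‖ + ‖star (A - B) * B‖ := norm_add_le _ _
        _ ≤ ‖star A‖ * ‖A - B‖ + ‖star (A - B)‖ * ‖B‖ :=
          add_le_add (norm_mul_le _ _) (norm_mul_le _ _)
        _ ≤ 1 * ‖A - B‖ + ‖A - B‖ * 1 := by
          rw [norm_star_operator, norm_star_operator]; gcongr
        _ = _ := by ring
    calc ‖φ A - φ B‖ = 2⁻¹ * ‖T * (star A * (A - B) + star (A - B) * B)‖ := by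
          rw [h1, norm_smul]; norm_num
      _ ≤ 2⁻¹ * (‖T‖ * (2 * ‖A - B‖)) := by
          gcongr
          exact (norm_mul_le _ _).trans (mul_le_mul_of_nonneg_left h2 (norm_nonneg _))
      _ = ‖T‖ * ‖A - B‖ := by ring
  have h0 : (0 : X →L[ℝ] X) ∈ s := by
    refine ⟨by simp, ?_⟩
    simpa using smul_mem_strongClosure (C := C.toNonUnitalSubalgebra) 0 hT
  obtain ⟨A, hA, hfix, -⟩ := hcon.exists_fixedPoint' hs hmaps h0 (edist_ne_top _ _)
  refine ⟨A, hA.2, (eq_boundedTransform ?_).symm⟩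
  have h : (2⁻¹ : ℝ) • (T * (1 + star A * A)) = A := hfix
  rw [← h, smul_inv_smul₀ two_ne_zero, h]

end BoundedTransform

/-! ### Density of contractions and of selfadjoint contractions -/

section Density

variable [CompleteSpace X]

theorem exists_contraction_starStrong_approx {C : NonUnitalStarSubalgebra ℝ (X →L[ℝ] X)}
    (hC : IsClosed (C : Set (X →L[ℝ] X))) {T : X →L[ℝ] X}
    (hT : T ∈ strongClosure (C : Set (X →L[ℝ] X))) (hT1 : ‖T‖ < 1)
    (F : Finset X) {b : ℝ} (hb : 0 < b) :
    ∃ B ∈ C, ‖B‖ ≤ 1 ∧ ∀ x ∈ F, ‖(B - T) x‖ < b ∧ ‖(star B - star T) x‖ < b := by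
  classical
  obtain ⟨A, hA, rfl⟩ := exists_boundedTransform_eq hT hT1
  -- The continuity estimate controls vectors of the form (1 + A*A)y, so x is pulled back through
  -- the inverse; z does the same for adjoints.
  let y : X → X := fun x => Ring.inverse (1 + star A * A) x
  let z : X → X := fun x => Ring.inverse (1 + star (star A) * star A) x
  have hy : ∀ x, (1 + star A * A) (y x) = x := fun x => by
    rw [← mul_apply_eq_comp, Ring.mul_inverse_cancel _ (isUnit_one_add_star_mul_self A), one_apply_eq_self]
  have hz : ∀ x, (1 + star (star A) * star A) (z x) = x := fun x => by
    rw [← mul_apply_eq_comp, Ring.mul_inverse_cancel _ (isUnit_one_add_star_mul_self (star A)), one_apply_eq_self]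
  obtain ⟨S, hS, hSA⟩ := exists_starStrong_approx hA
    (F.image y ∪ F.image (fun x => A (y x)) ∪ F.image z ∪ F.image (fun x => star A (z x)))
    -- The estimate costs 2 · b/3 + b/3.
    (b := b / 3) (by positivity)
  refine ⟨boundedTransform S, boundedTransform_mem hC hS, norm_boundedTransform_le S,
    fun x hx => ⟨?_, ?_⟩⟩
  · have h := norm_boundedTransform_sub_apply_le S A (y x)
    rw [hy] at h
    have h1 := (hSA (y x) (by simp only [Finset.mem_union, Finset.mem_image]; grind)).1
    have h2 := (hSA (A (y x)) (by simp only [Finset.mem_union, Finset.mem_image]; grind)).2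
    linarith
  · have h := norm_boundedTransform_sub_apply_le (star S) (star A) (z x)
    rw [hz] at h
    have h1 := (hSA (z x) (by simp only [Finset.mem_union, Finset.mem_image]; grind)).2
    have h2 := (hSA (star A (z x)) (by simp only [Finset.mem_union, Finset.mem_image]; grind)).1
    rw [star_star, star_star] at h
    rw [star_boundedTransform, star_boundedTransform]
    linarith

/-- Kaplansky's density theorem for real operator algebras, with approximation of adjoints. -/
theorem exists_contraction_starStrong_approx_of_norm_le {C : NonUnitalStarSubalgebra ℝ (X →L[ℝ] X)}
    (hC : IsClosed (C : Set (X →L[ℝ] X))) {T : X →L[ℝ] X}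
    (hT : T ∈ strongClosure (C : Set (X →L[ℝ] X))) (hT1 : ‖T‖ ≤ 1)
    (F : Finset X) {b : ℝ} (hb : 0 < b) :
    ∃ B ∈ C, ‖B‖ ≤ 1 ∧ ∀ x ∈ F, ‖(B - T) x‖ < b ∧ ‖(star B - star T) x‖ < b := by
  have hev : ∀ᶠ r : ℝ in 𝓝[<] 1, ∀ x ∈ F, |r - 1| * ‖x‖ < b / 2 := by
    rw [Filter.eventually_all_finset]
    intro x _
    have hc : Continuous fun r : ℝ => |r - 1| * ‖x‖ := by fun_prop
    exact ((hc.tendsto 1).eventually_lt_const (by simpa using hb)).filter_mono nhdsWithin_le_nhds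
  obtain ⟨r, hr, hr0, hr1⟩ := (hev.and (Ioo_mem_nhdsLT (zero_lt_one (α := ℝ)))).exists
  have hrT : ‖r • T‖ < 1 := by
    rw [norm_smul, Real.norm_eq_abs, abs_of_pos hr0]
    nlinarith [norm_nonneg T]
  obtain ⟨B, hB, hB1, h⟩ := exists_contraction_starStrong_approx hC
    (smul_mem_strongClosure (C := C.toNonUnitalSubalgebra) r hT) hrT F (half_pos hb)
  have aux : ∀ R : X →L[ℝ] X, ‖R‖ ≤ 1 → ∀ D : X →L[ℝ] X, ∀ x ∈ F,
      ‖(D - r • R) x‖ < b / 2 → ‖(D - R) x‖ < b := by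
    intro R hR D x hx hD
    have h1 : (D - R) x = (D - r • R) x + (r - 1) • R x := by
      simp only [sub_apply, smul_apply, sub_smul, one_smul]; abel
    have h2 : ‖(r - 1) • R x‖ ≤ |r - 1| * ‖x‖ := by
      rw [norm_smul, Real.norm_eq_abs]
      gcongr
      simpa using R.le_of_opNorm_le hR x
    rw [h1]
    linarith [norm_add_le ((D - r • R) x) ((r - 1) • R x), hr x hx]
  refine ⟨B, hB, hB1, fun x hx => ⟨aux T hT1 B x hx (h x hx).1,
    aux (star T) (by rwa [norm_star_operator]) (star B) x hx ?_⟩⟩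
  simpa only [star_smul, star_trivial] using (h x hx).2

theorem mem_strongClosure_contractions {C : NonUnitalStarSubalgebra ℝ (X →L[ℝ] X)}
    (hC : IsClosed (C : Set (X →L[ℝ] X))) {T : X →L[ℝ] X}
    (hT : T ∈ strongClosure (C : Set (X →L[ℝ] X))) (hT1 : ‖T‖ ≤ 1) :
    T ∈ strongClosure {S : X →L[ℝ] X | S ∈ C ∧ ‖S‖ ≤ 1} := by
  rw [mem_strongClosure_iff]
  intro F b hb
  obtain ⟨B, hB, hB1, h⟩ := exists_contraction_starStrong_approx_of_norm_le hC hT hT1 F hb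
  exact ⟨B, ⟨hB, hB1⟩, fun x hx => (h x hx).1⟩

theorem mem_strongClosure_selfAdjoint_contractions {C : NonUnitalStarSubalgebra ℝ (X →L[ℝ] X)}
    (hC : IsClosed (C : Set (X →L[ℝ] X))) {T : X →L[ℝ] X}
    (hT : T ∈ strongClosure (C : Set (X →L[ℝ] X))) (hT1 : ‖T‖ ≤ 1) (hTs : IsSelfAdjoint T) :
    T ∈ strongClosure {S : X →L[ℝ] X | S ∈ C ∧ ‖S‖ ≤ 1 ∧ IsSelfAdjoint S} := by
  rw [mem_strongClosure_iff]
  intro F b hb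
  obtain ⟨B, hB, hB1, h⟩ := exists_contraction_starStrong_approx_of_norm_le hC hT hT1 F hb
  -- As T* = T, B and B* both approximate T, hence so does their mean.
  refine ⟨(2⁻¹ : ℝ) • (B + star B), ⟨SMulMemClass.smul_mem _ (add_mem hB (star_mem hB)), ?_, ?_⟩,
    fun x hx => ?_⟩
  · rw [norm_smul, Real.norm_eq_abs, abs_of_pos (by norm_num)]
    have := norm_add_le B (star B)
    rw [norm_star_operator] at this
    linarith
  · rw [isSelfAdjoint_iff, star_smul, star_add, star_star, star_trivial, add_comm]
  · obtain ⟨h1, h2⟩ := h x hx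
    rw [hTs.star_eq] at h2
    have h3 : ((2⁻¹ : ℝ) • (B + star B) - T) x =
        (2⁻¹ : ℝ) • ((B - T) x + (star B - T) x) := by
      simp only [sub_apply, smul_apply, add_apply]
      module
    rw [h3, norm_smul, Real.norm_eq_abs, abs_of_pos (by norm_num)]
    linarith [norm_add_le ((B - T) x) ((star B - T) x)]

end Density

end

end HyperOp

theorem theorem3p75 :
    (∀ (X : Type*) [NormedAddCommGroup X] [InnerProductSpace ℝ X] [CompleteSpace X]
        [QuaternionHilbertSpace X] (C : NonUnitalStarSubalgebra ℝ (X →L[ℝ] X)),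
      IsCStarAlgebraOver ℍ[ℝ] C →
        (∀ T ∈ strongClosure (C : Set (X →L[ℝ] X)), ‖T‖ ≤ 1 →
          T ∈ strongClosure {S : X →L[ℝ] X | S ∈ C ∧ ‖S‖ ≤ 1}) ∧
        (∀ T ∈ strongClosure (C : Set (X →L[ℝ] X)), ‖T‖ ≤ 1 → IsSelfAdjoint T →
          T ∈ strongClosure {S : X →L[ℝ] X | S ∈ C ∧ ‖S‖ ≤ 1 ∧ IsSelfAdjoint S})) ∧
    (∀ (X : Type*) [NormedAddCommGroup X] [InnerProductSpace ℝ X] [CompleteSpace X]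
        [OctonionHilbertSpace X] (C : NonUnitalStarSubalgebra ℝ (X →L[ℝ] X)),
      IsCStarAlgebraOver Octonion C →
        (∀ T ∈ strongClosure (C : Set (X →L[ℝ] X)), ‖T‖ ≤ 1 →
          T ∈ strongClosure {S : X →L[ℝ] X | S ∈ C ∧ ‖S‖ ≤ 1}) ∧
        (∀ T ∈ strongClosure (C : Set (X →L[ℝ] X)), ‖T‖ ≤ 1 → IsSelfAdjoint T →
          T ∈ strongClosure {S : X →L[ℝ] X | S ∈ C ∧ ‖S‖ ≤ 1 ∧ IsSelfAdjoint S})) := by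
  exact ⟨fun _ _ _ _ _ _ hC => ⟨fun _ => mem_strongClosure_contractions hC.isClosed,
      fun _ => mem_strongClosure_selfAdjoint_contractions hC.isClosed⟩,
    fun _ _ _ _ _ _ hC => ⟨fun _ => mem_strongClosure_contractions hC.isClosed,
      fun _ => mem_strongClosure_selfAdjoint_contractions hC.isClosed⟩⟩
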